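/- **Setting.** The channel coefficients are $g_{kj}(t)$, $k,j\in\{1,2\}$, $t=1,2,\dots$, from transmitter $j$ to receiver $k$ at time $t$. They are i.i.d. complex random variables across $t,k,j$, with a common law that is continuous, i.e. gives mass zero to every point of $\mathbb C$. Let $G_{kj}^n$ be the $n\times n$ diagonal matrix with diagonal entries $g_{kj}(1),\dots,g_{kj}(n)$. **Linear strategies with delayed CSIT.** A strategy of block length $n$ with symbol numbers $m_{kj}\in\mathbb N=\{0,1,2,\dots\}$ (the number of symbols of transmitter $j$ for receiver $k$) consists of Borel functions $f_{k,j,t}$, $1\le t\le n$, that give the precoding vector $v_{kj}(t)\in\mathbb C^{m_{kj}}$ used in slot $t$ as a function of the channel coefficients of all four links in slots $1,\dots,t-1$ only. Let $V_{kj}^n$ be the $n\times m_{kj}$ matrix with rows $v_{kj}(t)^\top$. **Decodability.** With $k'=3-k$ and $j'=3-j$, let $\mathcal I_{kj}\subseteq\mathbb C^n$ be the subspace generated by the columns of $G_{kj}^nV_{k'j}^n$, $G_{kj'}^nV_{kj'}^n$ and $G_{kj'}^nV_{k'j'}^n$. The strategy is decodable almost surely if, with probability $1$, for all $k,j$, $$\dim\operatorname{Proj}_{\mathcal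 I_{kj}^{\perp}}\operatorname{colspan}(G_{kj}^nV_{kj}^n)=\dim\operatorname{colspan}(V_{kj}^n)=m_{kj}.$$ **Degrees of freedom.** A tuple $(d_{11},d_{12},d_{21},d_{22})$ is linearly achievable if there are, for each $n\ge 1$, numbers $m_{kj}(n)$ and a strategy of block length $n$ with these symbol numbers that is decodable almost surely, such that $\lim_{n\to\infty}m_{kj}(n)/n=d_{kj}$ for all $k,j$. Let $\mathcal D$ be the closure of the set of linearly achievable tuples. The sum linear degrees of freedom is $\mathrm{DoF}_{\text{L-sum}}=\max\{d_{11}+d_{12}+d_{21}+d_{22}:(d_{11},d_{12},d_{21},d_{22})\in\mathcal D\}$. **Theorem 1.** For the two-user Gaussian X-channel with delayed CSIT, the maximum exists and $$\mathrm{DoF}_{\text{L-sum}}=\frac65 .$$ Moreover, every $(d_{11},d_{12},d_{21},d_{22})\in\mathcal D$ satisfies $d_{11}+d_{12}+\frac32(d_{21}+d_{22})\le\frac32$ and $\frac32(d_{11}+d_{12})+d_{21}+d_{22}\le\frac32$; and there is a linear strategy of block length $5$ with $(m_{11},m_{12},m_{21},m_{22})=(2,1,1,2)$ that is decodable almost surely.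 -/

import Mathlib

open MeasureTheory ProbabilityTheory Filter Topology

noncomputable section

namespace XChannel

/-- A realization of the channel coefficients: `H t k j` is the coefficient at time slot `t` from
transmitter `j` to receiver `k`.  Slots, transmitters and receivers are numbered from `0`. -/
abbrev Channel : Type := ℕ → Fin 2 → Fin 2 → ℂ

/-- A linear coding strategy of block length `n` with delayed CSIT.  `m k j` is the number of
information symbols of transmitter `j` for receiver `k`.  The precoding vector used in slot `t`
is a (Borel) function of the channel coefficients of the slots `0, …, t - 1` only. -/
structure LinearStrategy (n : ℕ) (m : Fin 2 → Fin 2 → ℕ) where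
  /-- The precoding vector of transmitter `j` for receiver `k` in slot `t`, as a function of the
  past channel coefficients. -/
  precoder : ∀ (k j : Fin 2) (t : Fin n),
    (Fin t.val → Fin 2 → Fin 2 → ℂ) → Fin (m k j) → ℂ
  measurable_precoder : ∀ (k j : Fin 2) (t : Fin n), Measurable (precoder k j t)

/-- The diagonal matrix of the first `n` channel coefficients from transmitter `j` to
receiver `k`. -/
def channelMatrix (n : ℕ) (H : Channel) (k j : Fin 2) : Matrix (Fin n) (Fin n) ℂ :=
  Matrix.diagonal fun t => H t.val k j

/-- The overall precoding matrix of transmitter `j` for receiver `k`; its row `t` is the precoding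
vector of slot `t`. -/
def LinearStrategy.precodingMatrix {n : ℕ} {m : Fin 2 → Fin 2 → ℕ} (f : LinearStrategy n m)
    (H : Channel) (k j : Fin 2) : Matrix (Fin n) (Fin (m k j)) ℂ :=
  Matrix.of fun t => f.precoder k j t fun s => H s.val

/-- The column span of a matrix with `n` rows, as a subspace of the Hilbert space `ℂⁿ`. -/
def colSpan {n p : ℕ} (A : Matrix (Fin n) (Fin p) ℂ) :
    Submodule ℂ (EuclideanSpace ℂ (Fin n)) :=
  Submodule.span ℂ (Set.range fun i : Fin p => WithLp.toLp 2 fun t => A t i)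

/-- The subspace of `ℂⁿ` in which receiver `r` observes the symbols that transmitter `j` sends for
receiver `k`. -/
def LinearStrategy.receivedSpan {n : ℕ} {m : Fin 2 → Fin 2 → ℕ} (f : LinearStrategy n m)
    (H : Channel) (r k j : Fin 2) : Submodule ℂ (EuclideanSpace ℂ (Fin n)) :=
  colSpan (channelMatrix n H r j * f.precodingMatrix H k j)

/-- The interference subspace at receiver `k` for the symbols of transmitter `j` meant for it:
the subspace generated by the other three received streams.  Here `1 - k` and `1 - j` are the
other receiver and the other transmitter. -/
def LinearStrategy.interference {n : ℕ} {m : Fin 2 → Fin 2 → ℕ} (f : LinearStrategy n m)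
    (H : Channel) (k j : Fin 2) : Submodule ℂ (EuclideanSpace ℂ (Fin n)) :=
  f.receivedSpan H k (1 - k) j ⊔ f.receivedSpan H k k (1 - j) ⊔
    f.receivedSpan H k (1 - k) (1 - j)

/-- Decodability for the channel realization `H`: for each receiver `k` and each transmitter `j`,
the orthogonal projection of the received desired subspace onto the orthogonal complement of the
interference subspace, and the column span of the precoding matrix, both have dimension `m k j`. -/
def LinearStrategy.Decodable {n : ℕ} {m : Fin 2 → Fin 2 → ℕ} (f : LinearStrategy n m)
    (H : Channel) : Prop :=
  ∀ k j : Fin 2,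
    Module.finrank ℂ ((f.receivedSpan H k k j).map
      (f.interference H k j)ᗮ.starProjection.toLinearMap) = m k j ∧
    Module.finrank ℂ (colSpan (f.precodingMatrix H k j)) = m k j

variable {Ω : Type*} [MeasurableSpace Ω]

/-- Decodability with probability one for the random channel `g`. -/
def LinearStrategy.DecodableAS {n : ℕ} {m : Fin 2 → Fin 2 → ℕ} (f : LinearStrategy n m)
    (P : Measure Ω) (g : ℕ → Fin 2 → Fin 2 → Ω → ℂ) : Prop :=
  ∀ᵐ ω ∂P, f.Decodable fun t k j => g t k j ω

/-- The tuple `d`, with `d k j` the degrees of freedom from transmitter `j` to receiver `k`, is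
linearly achievable over the random channel `g`. -/
def LinearlyAchievable (P : Measure Ω) (g : ℕ → Fin 2 → Fin 2 → Ω → ℂ)
    (d : Fin 2 → Fin 2 → ℝ) : Prop :=
  ∃ (m : ℕ → Fin 2 → Fin 2 → ℕ) (f : ∀ n : ℕ, LinearStrategy n (m n)),
    (∀ n : ℕ, 1 ≤ n → (f n).DecodableAS P g) ∧
    ∀ k j : Fin 2, Tendsto (fun n : ℕ => (m n k j : ℝ) / (n : ℝ)) atTop (𝓝 (d k j))

/-- The linear degrees of freedom region: the closure of the set of linearly achievable tuples. -/
def linearDoFRegion (P : Measure Ω) (g : ℕ → Fin 2 → Fin 2 → Ω → ℂ) :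
    Set (Fin 2 → Fin 2 → ℝ) :=
  closure {d | LinearlyAchievable P g d}

/-- `s` is the sum linear degrees of freedom: the maximum of the sum of the four entries over the
linear degrees of freedom region. -/
def IsSumLinearDoF (P : Measure Ω) (g : ℕ → Fin 2 → Fin 2 → Ω → ℂ) (s : ℝ) : Prop :=
  IsGreatest ((fun d : Fin 2 → Fin 2 → ℝ => ∑ k, ∑ j, d k j) '' linearDoFRegion P g) s

end XChannel

end

/-! ### Null sets from independence, and measurability of span membership -/

namespace XChannel

/-! Converse. Fix a receiver `k`, let `E` and `F` be the symbol spaces of the two transmitters for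
`k`, and let `R ⊆ E × F` be the row space of what the other receiver sees of these symbols. Full
rank of the precoders makes `R` project onto `E` and onto `F`, so `R ∩ E` and `R ∩ F` have
dimensions `dim R - dim F` and `dim R - dim E`. When a slot adds nothing to the other receiver's
span, then almost surely both halves of the row lie separately in `R`: the precoding vectors are
fixed before the current coefficients are drawn, and these have no atoms (`ae_generic`). The row at
receiver `k` then lies in `(R ∩ E) ⊕ (R ∩ F)`. Its total rank `dim E + dim F` is thus at most `dim R
+ dim (R ∩ E) + dim (R ∩ F) = 3 dim R - dim E - dim F`, which is `rank_ratio`. Decodability at the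
other receiver leaves at most `n` minus its own symbol count for `dim R`. The two resulting
inequalities add up to the bound `6/5`.

Achievability. Two slots per receiver let the unintended receiver eliminate one transmitter's only
symbol. It then knows a combination of the other transmitter's two symbols, which is the missing
equation of the intended receiver. Sending both such combinations in slot five delivers six symbols
in five slots. -/

theorem ae_update_notMem {Ω ι : Type*} [MeasurableSpace Ω] [DecidableEq ι] {P : Measure Ω}
    [IsProbabilityMeasure P] {X : ι → Ω → ℂ} (hX : ∀ i, Measurable (X i)) (hindep : iIndepFun X P)
    (i₀ : ι) [NullSingletonClass (P.map (X i₀))] {B : Set (ι → ℂ)} (hB : MeasurableSet B)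
    (hsub : ∀ x, {z | Function.update x i₀ z ∈ B}.Subsingleton) :
    ∀ᵐ ω ∂P, (fun i => X i ω) ∉ B := by
  -- Overwriting coordinate `i₀` by `0` keeps the index type and makes `Y` a function of the other
  -- coordinates, hence independent of `X i₀`; Fubini then applies to the pair.
  set Y : Ω → ι → ℂ := fun ω => Function.update (fun i => X i ω) i₀ 0 with hY
  have hYm : Measurable[⨆ i ∈ ({i₀}ᶜ : Set ι), MeasurableSpace.comap (X i) inferInstance] Y := by
    rw [@measurable_pi_iff]
    intro i
    by_cases hi : i = i₀
    · subst hi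
      simp only [hY, Function.update_self]
      exact @measurable_const _ _ _ (_) _
    · simp only [hY, Function.update_of_ne hi]
      refine Measurable.mono (comap_measurable (X i)) ?_ le_rfl
      exact le_iSup₂_of_le i hi le_rfl
  have hYm' : Measurable Y := hYm.mono (iSup₂_le fun i _ => (hX i).comap_le) le_rfl
  have hind : IndepFun Y (X i₀) P := by
    have h := indep_iSup_of_disjoint (fun i => (hX i).comap_le) hindep.iIndep
      (disjoint_compl_left (a := ({i₀} : Set ι)))
    rw [IndepFun_iff_Indep]
    refine indep_of_indep_of_le_left (indep_of_indep_of_le_right h ?_) hYm.comap_le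
    simp
  have hprod := (indepFun_iff_map_prod_eq_prod_map_map hYm'.aemeasurable
    (hX i₀).aemeasurable).1 hind
  have hupd : Measurable fun p : (ι → ℂ) × ℂ => Function.update p.1 i₀ p.2 := by
    rw [measurable_pi_iff]
    intro i
    by_cases hi : i = i₀
    · subst hi; simpa using measurable_snd
    · simp only [Function.update_of_ne hi]
      exact (measurable_pi_apply i).comp measurable_fst
  have := Measure.isProbabilityMeasure_map (μ := P) (hX i₀).aemeasurable
  have hnull : (P.map fun ω => (Y ω, X i₀ ω))
      ((fun p : (ι → ℂ) × ℂ => Function.update p.1 i₀ p.2) ⁻¹' B) = 0 := by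
    rw [hprod, Measure.measure_prod_null (hupd hB)]
    exact Eventually.of_forall fun x => (hsub x).measure_zero _
  rw [Measure.map_apply (hYm'.prodMk (hX i₀)) (hupd hB)] at hnull
  rw [ae_iff]
  convert hnull using 2
  ext ω
  simp [hY]

/-- A measurable set of channels which determines one coefficient from all the others is null. -/
theorem ae_channel_notMem {Ω : Type*} [MeasurableSpace Ω] {P : Measure Ω}
    [IsProbabilityMeasure P] {g : ℕ → Fin 2 → Fin 2 → Ω → ℂ}
    (hmeas : ∀ t k j, Measurable (g t k j))
    (hindep : iIndepFun (fun i : ℕ × Fin 2 × Fin 2 => g i.1 i.2.1 i.2.2) P)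
    (t : ℕ) (k j : Fin 2) [NullSingletonClass (P.map (g t k j))] {B : Set Channel}
    (hB : MeasurableSet B)
    (hsub : ∀ H ∈ B, ∀ H' ∈ B,
      (∀ s r l, (s, r, l) ≠ (t, k, j) → H s r l = H' s r l) → H t k j = H' t k j) :
    ∀ᵐ ω ∂P, (fun t k j => g t k j ω) ∉ B := by
  have : NullSingletonClass (P.map ((fun i : ℕ × Fin 2 × Fin 2 => g i.1 i.2.1 i.2.2) (t, k, j))) :=
    ‹_›
  have hcurry : Measurable fun (x : ℕ × Fin 2 × Fin 2 → ℂ) (t : ℕ) (k j : Fin 2) => x (t, k, j) := by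
    fun_prop
  refine ae_update_notMem (fun i => hmeas _ _ _) hindep (t, k, j) (hcurry hB) ?_
  intro x z hz z' hz'
  have := hsub _ hz _ hz' fun s r l h => by simp [Function.update_of_ne h]
  simpa using this

theorem ae_channel_ne_zero {Ω : Type*} [MeasurableSpace Ω] {P : Measure Ω}
    [IsProbabilityMeasure P] {g : ℕ → Fin 2 → Fin 2 → Ω → ℂ}
    (hmeas : ∀ t k j, Measurable (g t k j)) (hatom : ∀ t k j, NullSingletonClass (P.map (g t k j))) :
    ∀ᵐ ω ∂P, ∀ t k j, g t k j ω ≠ 0 := by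
  simp only [ae_all_iff]
  intro t k j
  rw [ae_iff]
  have := measure_singleton (μ := P.map (g t k j)) 0
  rw [Measure.map_apply (hmeas t k j) (measurableSet_singleton 0)] at this
  simpa [Set.preimage] using this

/-- A finite-dimensional span is closed, so membership means approximation by combinations whose
coefficients come from a countable dense set. -/
theorem measurableSet_mem_span {Ω E : Type*} [MeasurableSpace Ω] [NormedAddCommGroup E]
    [NormedSpace ℂ E] [FiniteDimensional ℂ E] [MeasurableSpace E] [BorelSpace E]
    {n : ℕ} {v : Fin n → Ω → E} {w : Ω → E} (hv : ∀ i, Measurable (v i)) (hw : Measurable w) :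
    MeasurableSet {ω | w ω ∈ Submodule.span ℂ (Set.range fun i => v i ω)} := by
  have := FiniteDimensional.proper ℂ E
  have : SecondCountableTopology E := inferInstance
  have key : {ω | w ω ∈ Submodule.span ℂ (Set.range fun i => v i ω)} =
      ⋂ k : ℕ, ⋃ i : ℕ, {ω | ‖w ω - ∑ l, TopologicalSpace.denseSeq (Fin n → ℂ) i l • v l ω‖
        < 1 / ((k : ℝ) + 1)} := by
    ext ω
    simp only [Set.mem_ofPred_eq, Set.mem_iInter, Set.mem_iUnion]
    constructor
    · intro h k
      obtain ⟨c, hc⟩ := (Submodule.mem_span_range_iff_exists_fun ℂ).1 h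
      have hopen : IsOpen {c : Fin n → ℂ | ‖w ω - ∑ l, c l • v l ω‖ < 1 / ((k : ℝ) + 1)} :=
        isOpen_lt (by fun_prop) continuous_const
      exact (TopologicalSpace.denseRange_denseSeq (Fin n → ℂ)).exists_mem_open hopen
        ⟨c, by simp only [Set.mem_ofPred_eq, hc, sub_self, norm_zero]; positivity⟩
    · intro h
      have hcl := (Submodule.span ℂ (Set.range fun i => v i ω)).closed_of_finiteDimensional
      rw [← SetLike.mem_coe, ← hcl.closure_eq, Metric.mem_closure_iff]
      intro ε hε
      obtain ⟨k, hk⟩ := exists_nat_one_div_lt hε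
      obtain ⟨i, hi⟩ := h k
      refine ⟨_, ?_, (dist_eq_norm _ _).trans_lt (hi.trans hk)⟩
      exact Submodule.sum_mem _ fun l _ => Submodule.smul_mem _ _ (Submodule.subset_span ⟨l, rfl⟩)
  rw [key]
  refine MeasurableSet.iInter fun k => MeasurableSet.iUnion fun i => ?_
  refine measurableSet_lt ?_ measurable_const
  exact (hw.sub (Finset.measurable_sum _ fun l _ => (hv l).const_smul _)).norm

end XChannel

/-! ### Linear algebra of the rank ratio -/

namespace XChannel

open Module Submodule

variable {K E F : Type*} [Field K] [AddCommGroup E] [Module K E] [AddCommGroup F] [Module K F]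

/-- Rank-nullity for the second projection restricted to `R`, whose kernel is `R ∩ (E × 0)`. -/
theorem finrank_comap_inl_add [FiniteDimensional K E] [FiniteDimensional K F]
    (R : Submodule K (E × F)) (hR : R.map (LinearMap.snd K E F) = ⊤) :
    finrank K (R.comap (LinearMap.inl K E F)) + finrank K F = finrank K R := by
  have h := (LinearMap.snd K E F ∘ₗ R.subtype).finrank_range_add_finrank_ker
  rw [LinearMap.range_comp, range_subtype, hR, finrank_top] at h
  have hker : (LinearMap.ker (LinearMap.snd K E F ∘ₗ R.subtype)).map R.subtype =
      (R.comap (LinearMap.inl K E F)).map (LinearMap.inl K E F) := by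
    ext ⟨x, y⟩
    constructor
    · rintro ⟨⟨⟨x', y'⟩, hz⟩, h0, h1⟩
      obtain ⟨rfl, rfl⟩ := Prod.mk.inj h1
      obtain rfl : y' = 0 := h0
      exact ⟨x', hz, rfl⟩
    · rintro ⟨x', hz, h⟩
      exact ⟨⟨_, hz⟩, rfl, h⟩
  have h1 := LinearEquiv.finrank_eq (equivMapOfInjective R.subtype R.injective_subtype
    (LinearMap.ker (LinearMap.snd K E F ∘ₗ R.subtype)))
  have h2 := LinearEquiv.finrank_eq (equivMapOfInjective (LinearMap.inl K E F)
    LinearMap.inl_injective (R.comap (LinearMap.inl K E F)))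
  rw [hker] at h1
  omega

theorem finrank_comap_inr_add [FiniteDimensional K E] [FiniteDimensional K F]
    (R : Submodule K (E × F)) (hR : R.map (LinearMap.fst K E F) = ⊤) :
    finrank K (R.comap (LinearMap.inr K E F)) + finrank K E = finrank K R := by
  have h := finrank_comap_inl_add (R.map (LinearEquiv.prodComm K E F).toLinearMap) (by
    rw [← map_comp]; exact hR)
  rw [LinearEquiv.finrank_map_eq] at h
  rw [← h]
  suffices R.comap (LinearMap.inr K E F) = (R.map (LinearEquiv.prodComm K E F).toLinearMap).comap
      (LinearMap.inl K F E) by rw [this]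
  ext y
  simp

/-- If a row is in the span of the preceding rows only when both its halves are, then the
increments of the span of a second family made of the same halves are controlled. -/
theorem finrank_sup_span_le [FiniteDimensional K E] {n : ℕ} (u w : Fin n → E) (R : Submodule K E)
    (hstep : ∀ t, u t ∈ span K (u '' Set.Iio t) → w t ∈ R) :
    finrank K ↥(span K (Set.range w) ⊔ R) ≤ finrank K (span K (Set.range u)) + finrank K R := by
  have key : ∀ s : ℕ, s ≤ n → finrank K ↥(span K (w '' {t | t.val < s}) ⊔ R) ≤
      finrank K (span K (u '' {t | t.val < s})) + finrank K R := by
    intro s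
    induction s with
    | zero =>
      have hempty : {t : Fin n | t.val < 0} = ∅ := by ext i; simp
      rw [hempty, Set.image_empty, Set.image_empty, span_empty, bot_sup_eq]
      exact fun _ => Nat.le_add_left _ _
    | succ s ih =>
      intro hs
      have ih := ih (by omega)
      set t : Fin n := ⟨s, by omega⟩ with ht
      have hset : {t : Fin n | t.val < s + 1} = insert t {t | t.val < s} := by
        ext i; simp [ht, Fin.ext_iff]; omega
      have hIio : {t : Fin n | t.val < s} = Set.Iio t := by
        ext i; simp [ht, Fin.lt_def]
      rw [hset, Set.image_insert_eq, Set.image_insert_eq, span_insert, span_insert, sup_assoc]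
      -- Either `u t` adds a dimension and pays for the at most one that `w t` adds, or `w t`
      -- already lies in `R`.
      by_cases hu : u t ∈ span K (u '' {t | t.val < s})
      · have hw : w t ∈ R := hstep t (hIio ▸ hu)
        have e1 : span K {w t} ⊔ (span K (w '' {t | t.val < s}) ⊔ R) =
            span K (w '' {t | t.val < s}) ⊔ R :=
          sup_eq_right.2 ((span_singleton_le_iff_mem _ _).2 (mem_sup_right hw))
        have e2 : span K {u t} ⊔ span K (u '' {t | t.val < s}) = span K (u '' {t | t.val < s}) :=
          sup_eq_right.2 ((span_singleton_le_iff_mem _ _).2 hu)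
        rw [e1, e2]
        exact ih
      · have h1 : finrank K (span K (u '' {t | t.val < s})) <
            finrank K ↥(span K {u t} ⊔ span K (u '' {t | t.val < s})) :=
          finrank_lt_finrank_of_lt (lt_of_le_of_ne le_sup_right fun h => hu <| by
            rw [h]; exact mem_sup_left (mem_span_singleton_self _))
        have h2 := finrank_add_le_finrank_add_finrank (span K {w t})
          (span K (w '' {t | t.val < s}) ⊔ R)
        have h3 : finrank K (span K {w t}) ≤ 1 :=
          (finrank_span_le_card ({w t} : Set E)).trans (by simp)
        omega
  have h := key n le_rfl
  have huniv : {t : Fin n | t.val < n} = Set.univ := by ext i; simp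
  rwa [huniv, Set.image_univ, Set.image_univ] at h

theorem map_span_smul_eq_top {n : ℕ} {x : Fin n → E} {z : Fin n → F} {c : Fin n → K}
    (f : F →ₗ[K] E) (hx : span K (Set.range x) = ⊤) (hc : ∀ t, c t ≠ 0)
    (hf : ∀ t, f (z t) = c t • x t) : (span K (Set.range z)).map f = ⊤ := by
  rw [map_span, ← Set.range_comp, eq_top_iff, ← hx, span_le]
  rintro _ ⟨t, rfl⟩
  have : c t • x t ∈ span K (Set.range (f ∘ z)) := subset_span ⟨t, hf t⟩
  simpa [smul_smul, hc t] using smul_mem _ (c t)⁻¹ this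

/-- The rank ratio inequality for two distributed transmitters. -/
theorem rank_ratio [FiniteDimensional K E] [FiniteDimensional K F] {n : ℕ}
    (x : Fin n → E) (y : Fin n → F) (p q p' q' : Fin n → K)
    (hp : ∀ t, p t ≠ 0) (hq : ∀ t, q t ≠ 0)
    (hx : span K (Set.range x) = ⊤) (hy : span K (Set.range y) = ⊤)
    (hS : span K (Set.range fun t => (p' t • x t, q' t • y t)) = ⊤)
    (hgen : ∀ t, (p t • x t, q t • y t) ∈ span K ((fun t => (p t • x t, q t • y t)) '' Set.Iio t) →
      (x t, (0 : F)) ∈ span K ((fun t => (p t • x t, q t • y t)) '' Set.Iio t) ∧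
      ((0 : E), y t) ∈ span K ((fun t => (p t • x t, q t • y t)) '' Set.Iio t)) :
    2 * (finrank K E + finrank K F) ≤
      3 * finrank K (span K (Set.range fun t => (p t • x t, q t • y t))) := by
  set R := span K (Set.range fun t => (p t • x t, q t • y t)) with hR
  have h1 := finrank_comap_inl_add R (map_span_smul_eq_top _ hy hq fun t => rfl)
  have h2 := finrank_comap_inr_add R (map_span_smul_eq_top _ hx hp fun t => rfl)
  -- The absorbing subspace is `(R ∩ E) ⊕ (R ∩ F)`: it contains each half of a row that brings
  -- nothing new, whatever the scalars `p'`, `q'`.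
  have h3 := finrank_sup_span_le (fun t => (p t • x t, q t • y t))
    (fun t => (p' t • x t, q' t • y t))
    ((R.comap (LinearMap.inl K E F)).map (LinearMap.inl K E F) ⊔
      (R.comap (LinearMap.inr K E F)).map (LinearMap.inr K E F)) fun t ht => by
    have hle : span K ((fun t => (p t • x t, q t • y t)) '' Set.Iio t) ≤ R :=
      span_mono (Set.image_subset_range _ _)
    have hsum : (p' t • x t, q' t • y t) =
        p' t • LinearMap.inl K E F (x t) + q' t • LinearMap.inr K E F (y t) := by simp
    rw [hsum]
    exact add_mem (mem_sup_left (smul_mem _ _ (mem_map_of_mem (hle (hgen t ht).1))))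
      (mem_sup_right (smul_mem _ _ (mem_map_of_mem (hle (hgen t ht).2))))
  rw [hS, top_sup_eq, finrank_top, finrank_prod] at h3
  have h4 := finrank_add_le_finrank_add_finrank
    ((R.comap (LinearMap.inl K E F)).map (LinearMap.inl K E F))
    ((R.comap (LinearMap.inr K E F)).map (LinearMap.inr K E F))
  have h5 := finrank_map_le (LinearMap.inl K E F) (R.comap (LinearMap.inl K E F))
  have h6 := finrank_map_le (LinearMap.inr K E F) (R.comap (LinearMap.inr K E F))
  rw [← hR] at h3
  omega

end XChannel

/-! ### From decodability to a dimension inequality for one realization -/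

namespace XChannel

open Module Submodule

theorem mem_colSpan {n p : ℕ} {A : Matrix (Fin n) (Fin p) ℂ} {v : EuclideanSpace ℂ (Fin n)} :
    v ∈ colSpan A ↔ ∃ c : Fin p → ℂ, WithLp.toLp 2 (A.mulVec c) = v := by
  rw [colSpan, Submodule.mem_span_range_iff_exists_fun]
  refine exists_congr fun c => ?_
  rw [iff_iff_eq]
  congr 1
  ext t
  simp [Matrix.mulVec, dotProduct, mul_comm]

theorem finrank_colSpan {n p : ℕ} (A : Matrix (Fin n) (Fin p) ℂ) :
    finrank ℂ (colSpan A) = A.rank := by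
  have h : colSpan A = (LinearMap.range A.mulVecLin).map
      (WithLp.linearEquiv 2 ℂ (Fin n → ℂ)).symm.toLinearMap := by
    ext v
    simp only [mem_colSpan, Submodule.mem_map, LinearMap.mem_range]
    constructor
    · rintro ⟨c, rfl⟩
      exact ⟨_, ⟨c, rfl⟩, rfl⟩
    · rintro ⟨_, ⟨c, rfl⟩, rfl⟩
      exact ⟨c, rfl⟩
  rw [h, LinearEquiv.finrank_map_eq, Matrix.rank]

theorem colSpan_sup {n p q : ℕ} (A : Matrix (Fin n) (Fin p) ℂ) (B : Matrix (Fin n) (Fin q) ℂ) :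
    finrank ℂ ↥(colSpan A ⊔ colSpan B) = (Matrix.fromCols A B).rank := by
  have h : colSpan A ⊔ colSpan B = (LinearMap.range (Matrix.fromCols A B).mulVecLin).map
      (WithLp.linearEquiv 2 ℂ (Fin n → ℂ)).symm.toLinearMap := by
    ext v
    simp only [Submodule.mem_sup, mem_colSpan, Submodule.mem_map, LinearMap.mem_range]
    constructor
    · rintro ⟨_, ⟨c, rfl⟩, _, ⟨d, rfl⟩, rfl⟩
      exact ⟨_, ⟨Sum.elim c d, rfl⟩, by simp [Matrix.fromCols_mulVec]⟩
    · rintro ⟨_, ⟨c, rfl⟩, rfl⟩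
      exact ⟨_, ⟨c ∘ Sum.inl, rfl⟩, _, ⟨c ∘ Sum.inr, rfl⟩, by simp [Matrix.fromCols_mulVec]⟩
  rw [h, LinearEquiv.finrank_map_eq, Matrix.rank]

/-- Passes from columns to rows, because the converse follows the signal slot by slot. -/
theorem rank_fromCols {n p q : ℕ} (A : Matrix (Fin n) (Fin p) ℂ) (B : Matrix (Fin n) (Fin q) ℂ) :
    (Matrix.fromCols A B).rank = finrank ℂ (span ℂ (Set.range fun t => (A t, B t))) := by
  rw [Matrix.rank_eq_finrank_span_row, ← LinearEquiv.finrank_map_eq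
    (LinearEquiv.sumArrowLequivProdArrow (Fin p) (Fin q) ℂ ℂ), map_span, ← Set.range_comp]
  rfl

theorem span_rows_eq_top {n p : ℕ} {A : Matrix (Fin n) (Fin p) ℂ} (hA : A.rank = p) :
    span ℂ (Set.range fun t => A t) = ⊤ := by
  apply eq_top_of_finrank_eq
  rw [Matrix.rank_eq_finrank_span_row] at hA
  exact hA.trans (by simp)

theorem channelMatrix_mul_apply {n p : ℕ} (H : Channel) (r j : Fin 2)
    (A : Matrix (Fin n) (Fin p) ℂ) (t : Fin n) :
    (channelMatrix n H r j * A) t = H t r j • A t := by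
  ext i
  simp [channelMatrix, Matrix.diagonal_mul]

section Hilbert

variable {E : Type*} [NormedAddCommGroup E] [InnerProductSpace ℂ E] [FiniteDimensional ℂ E]

/-- The kernel of the projection onto `Wᗮ` is `W`, so keeping the dimension of `U` forces a trivial
intersection. -/
theorem disjoint_of_finrank_map_starProjection {U W : Submodule ℂ E}
    (h : finrank ℂ (U.map Wᗮ.starProjection.toLinearMap) = finrank ℂ U) : Disjoint U W := by
  have h1 := (Wᗮ.starProjection.toLinearMap ∘ₗ U.subtype).finrank_range_add_finrank_ker
  rw [LinearMap.range_comp, range_subtype, h] at h1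
  have h2 : LinearMap.ker (Wᗮ.starProjection.toLinearMap ∘ₗ U.subtype) = ⊥ :=
    finrank_eq_zero.1 (by omega)
  rw [disjoint_def]
  intro x hU hW
  have : (⟨x, hU⟩ : U) ∈ LinearMap.ker (Wᗮ.starProjection.toLinearMap ∘ₗ U.subtype) := by
    change Wᗮ.starProjection x = 0
    rwa [starProjection_apply_eq_zero_iff, orthogonal_orthogonal]
  rw [h2] at this
  simpa using this

theorem finrank_map_starProjection_of_disjoint {U W : Submodule ℂ E} (h : Disjoint U W) :
    finrank ℂ (U.map Wᗮ.starProjection.toLinearMap) = finrank ℂ U := by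
  have h1 := (Wᗮ.starProjection.toLinearMap ∘ₗ U.subtype).finrank_range_add_finrank_ker
  have h2 : LinearMap.ker (Wᗮ.starProjection.toLinearMap ∘ₗ U.subtype) = ⊥ := by
    rw [LinearMap.ker_eq_bot']
    rintro ⟨x, hU⟩ hx
    have hx : Wᗮ.starProjection x = 0 := hx
    rw [starProjection_apply_eq_zero_iff, orthogonal_orthogonal] at hx
    simpa using disjoint_def.1 h x hU hx
  rw [LinearMap.range_comp, range_subtype, h2, finrank_bot] at h1
  omega

end Hilbert
variable {n : ℕ} {m : Fin 2 → Fin 2 → ℕ} {f : LinearStrategy n m} {H : Channel}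

theorem finrank_receivedSpan_le (f : LinearStrategy n m) (H : Channel) (r k j : Fin 2) :
    finrank ℂ (f.receivedSpan H r k j) ≤ m k j := by
  rw [LinearStrategy.receivedSpan, finrank_colSpan]
  exact (Matrix.rank_le_width _)

theorem LinearStrategy.Decodable.finrank_receivedSpan (h : f.Decodable H) (k j : Fin 2) :
    finrank ℂ (f.receivedSpan H k k j) = m k j := by
  have h1 := finrank_map_le (f.interference H k j)ᗮ.starProjection.toLinearMap
    (f.receivedSpan H k k j)
  have h2 := finrank_receivedSpan_le f H k k j
  have h3 := (h k j).1
  omega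

theorem LinearStrategy.Decodable.disjoint (h : f.Decodable H) (k j : Fin 2) :
    Disjoint (f.receivedSpan H k k j) (f.interference H k j) :=
  disjoint_of_finrank_map_starProjection ((h k j).1.trans (h.finrank_receivedSpan k j).symm)

theorem finrank_sup_of_disjoint {K V : Type*} [Field K] [AddCommGroup V] [Module K V]
    [FiniteDimensional K V] {U W : Submodule K V} (h : Disjoint U W) :
    finrank K ↥(U ⊔ W) = finrank K U + finrank K W := by
  have := finrank_sup_add_finrank_inf_eq U W
  rw [h.eq_bot, finrank_bot] at this
  omega

theorem LinearStrategy.Decodable.finrank_desired (h : f.Decodable H) (k : Fin 2) :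
    finrank ℂ ↥(f.receivedSpan H k k 0 ⊔ f.receivedSpan H k k 1) = m k 0 + m k 1 := by
  have hd : Disjoint (f.receivedSpan H k k 0) (f.receivedSpan H k k 1) :=
    (h.disjoint k 0).mono_right (le_sup_of_le_left le_sup_right)
  rw [finrank_sup_of_disjoint hd, h.finrank_receivedSpan, h.finrank_receivedSpan]

/-- At receiver `1 - k` the two desired streams and the total interference are independent subspaces
of `ℂⁿ`. -/
theorem LinearStrategy.Decodable.finrank_interfering_le (h : f.Decodable H) (k : Fin 2) :
    finrank ℂ ↥(f.receivedSpan H (1 - k) k 0 ⊔ f.receivedSpan H (1 - k) k 1) +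
      (m (1 - k) 0 + m (1 - k) 1) ≤ n := by
  have hk : 1 - (1 - k) = k := by fin_cases k <;> rfl
  have h0 := h.disjoint (1 - k) 0
  have h1 := h.disjoint (1 - k) 1
  simp only [LinearStrategy.interference, hk] at h0 h1
  have h1' : Disjoint (f.receivedSpan H (1 - k) (1 - k) 1)
      (f.receivedSpan H (1 - k) k 0 ⊔ f.receivedSpan H (1 - k) k 1) :=
    h1.mono_right (sup_le le_sup_right (le_sup_of_le_left le_sup_left))
  have h0' : Disjoint (f.receivedSpan H (1 - k) (1 - k) 0)
      (f.receivedSpan H (1 - k) (1 - k) 1 ⊔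
        (f.receivedSpan H (1 - k) k 0 ⊔ f.receivedSpan H (1 - k) k 1)) :=
    h0.mono_right (sup_le (le_sup_of_le_left le_sup_right)
      (sup_le (le_sup_of_le_left le_sup_left) le_sup_right))
  have hle := finrank_le (f.receivedSpan H (1 - k) (1 - k) 0 ⊔
    (f.receivedSpan H (1 - k) (1 - k) 1 ⊔
      (f.receivedSpan H (1 - k) k 0 ⊔ f.receivedSpan H (1 - k) k 1)))
  rw [finrank_sup_of_disjoint h0', finrank_sup_of_disjoint h1', h.finrank_receivedSpan,
    h.finrank_receivedSpan, finrank_euclideanSpace_fin] at hle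
  omega

/-- The row of slot `t` in the matrix that receiver `r` sees for the symbols meant for
receiver `k`. -/
def LinearStrategy.row (f : LinearStrategy n m) (H : Channel) (r k : Fin 2) (t : Fin n) :
    (Fin (m k 0) → ℂ) × (Fin (m k 1) → ℂ) :=
  (H t r 0 • f.precodingMatrix H k 0 t, H t r 1 • f.precodingMatrix H k 1 t)

/-- Whenever receiver `r` gains no dimension from the symbols for receiver `k`, it already knows
what both transmitters send separately. -/
def LinearStrategy.Generic (f : LinearStrategy n m) (H : Channel) (r k : Fin 2) : Prop :=
  ∀ t : Fin n, f.row H r k t ∈ span ℂ (f.row H r k '' Set.Iio t) →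
    (f.precodingMatrix H k 0 t, (0 : Fin (m k 1) → ℂ)) ∈ span ℂ (f.row H r k '' Set.Iio t) ∧
    ((0 : Fin (m k 0) → ℂ), f.precodingMatrix H k 1 t) ∈ span ℂ (f.row H r k '' Set.Iio t)

theorem finrank_receivedSpan_sup (f : LinearStrategy n m) (H : Channel) (r k : Fin 2) :
    finrank ℂ ↥(f.receivedSpan H r k 0 ⊔ f.receivedSpan H r k 1) =
      finrank ℂ (span ℂ (Set.range (f.row H r k))) := by
  rw [LinearStrategy.receivedSpan, LinearStrategy.receivedSpan, colSpan_sup, rank_fromCols]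
  have hrow : (fun t => ((channelMatrix n H r 0 * f.precodingMatrix H k 0) t,
      (channelMatrix n H r 1 * f.precodingMatrix H k 1) t)) = f.row H r k :=
    funext fun t => Prod.ext (channelMatrix_mul_apply _ _ _ _ _) (channelMatrix_mul_apply _ _ _ _ _)
  rw [hrow]

/-- The interference rank is bounded below by `rank_ratio` and above by decodability at receiver `1
- k`. -/
theorem LinearStrategy.Decodable.dimension_bound (h : f.Decodable H) (hH : ∀ t k j, H t k j ≠ 0)
    (k : Fin 2) (hgen : f.Generic H (1 - k) k) :
    2 * (m k 0 + m k 1) + 3 * (m (1 - k) 0 + m (1 - k) 1) ≤ 3 * n := by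
  have h1 := h.finrank_interfering_le k
  have h2 := h.finrank_desired k
  rw [finrank_receivedSpan_sup] at h1 h2
  have h3 := rank_ratio (fun t => f.precodingMatrix H k 0 t) (fun t => f.precodingMatrix H k 1 t)
    (fun t => H t (1 - k) 0) (fun t => H t (1 - k) 1) (fun t => H t k 0) (fun t => H t k 1)
    (fun t => hH _ _ _) (fun t => hH _ _ _)
    (span_rows_eq_top ((finrank_colSpan _).symm.trans (h k 0).2))
    (span_rows_eq_top ((finrank_colSpan _).symm.trans (h k 1).2))
    (eq_top_of_finrank_eq (h2.trans (by simp))) hgen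
  have h4 : 2 * (m k 0 + m k 1) ≤ 3 * finrank ℂ (span ℂ (Set.range (f.row H (1 - k) k))) := by
    rw [finrank_fin_fun, finrank_fin_fun] at h3
    exact h3
  omega

end XChannel

/-! ### Almost sure genericity and the outer bound -/

namespace XChannel

open Module Submodule

variable {n : ℕ} {m : Fin 2 → Fin 2 → ℕ}

/-- Delayed CSIT enters here: changing the coefficients of slot `t` leaves the precoding vectors of
slot `t` unchanged. -/
theorem precodingMatrix_congr (f : LinearStrategy n m) {H H' : Channel} (k j : Fin 2) {t : Fin n}
    (h : ∀ s < t.val, H s = H' s) : f.precodingMatrix H k j t = f.precodingMatrix H' k j t := by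
  change f.precoder k j t _ = f.precoder k j t _
  congr 1
  exact funext fun s => h s s.2

theorem row_congr (f : LinearStrategy n m) {H H' : Channel} (r k : Fin 2) {t : Fin n}
    (h : ∀ s ≤ t.val, H s = H' s) : f.row H r k t = f.row H' r k t := by
  rw [LinearStrategy.row, LinearStrategy.row, h t le_rfl,
    precodingMatrix_congr f k 0 fun s hs => h s hs.le,
    precodingMatrix_congr f k 1 fun s hs => h s hs.le]

theorem measurable_precodingMatrix (f : LinearStrategy n m) (k j : Fin 2) (t : Fin n) :
    Measurable fun H : Channel => f.precodingMatrix H k j t :=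
  (f.measurable_precoder k j t).comp (measurable_pi_lambda _ fun _ => measurable_pi_apply _)

theorem measurable_row (f : LinearStrategy n m) (r k : Fin 2) (t : Fin n) :
    Measurable fun H : Channel => f.row H r k t := by
  have h (j : Fin 2) : Measurable fun H : Channel => H t r j := by fun_prop
  exact ((h 0).smul (measurable_precodingMatrix f k 0 t)).prodMk
    ((h 1).smul (measurable_precodingMatrix f k 1 t))

theorem measurableSet_mem_span_row (f : LinearStrategy n m) (r k : Fin 2) (t : Fin n)
    {w : Channel → (Fin (m k 0) → ℂ) × (Fin (m k 1) → ℂ)} (hw : Measurable w) :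
    MeasurableSet {H | w H ∈ span ℂ (f.row H r k '' Set.Iio t)} := by
  have hset (H : Channel) : f.row H r k '' Set.Iio t =
      Set.range fun s : Fin t.val => f.row H r k ⟨s, s.2.trans t.2⟩ := by
    ext v
    constructor
    · rintro ⟨s, hs, rfl⟩
      exact ⟨⟨s, hs⟩, rfl⟩
    · rintro ⟨s, rfl⟩
      exact ⟨_, s.2, rfl⟩
  simp only [hset]
  exact measurableSet_mem_span (fun s => measurable_row f r k _) hw

variable {Ω : Type*} [MeasurableSpace Ω] {P : Measure Ω} [IsProbabilityMeasure P]
  {g : ℕ → Fin 2 → Fin 2 → Ω → ℂ}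

/-- With everything but one current coefficient fixed, at most one value of it can put the row into
the past span while leaving that transmitter's half outside, so the exceptional set is null. -/
theorem ae_generic (hmeas : ∀ t k j, Measurable (g t k j))
    (hindep : iIndepFun (fun i : ℕ × Fin 2 × Fin 2 => g i.1 i.2.1 i.2.2) P)
    (hatom : ∀ t k j, NullSingletonClass (P.map (g t k j)))
    (f : LinearStrategy n m) (r k : Fin 2) :
    ∀ᵐ ω ∂P, f.Generic (fun t k j => g t k j ω) r k := by
  simp only [LinearStrategy.Generic, ae_all_iff]
  intro t
  have hw0 : Measurable fun H : Channel =>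
      (f.precodingMatrix H k 0 t, (0 : Fin (m k 1) → ℂ)) :=
    (measurable_precodingMatrix f k 0 t).prodMk measurable_const
  have hw1 : Measurable fun H : Channel =>
      ((0 : Fin (m k 0) → ℂ), f.precodingMatrix H k 1 t) :=
    measurable_const.prodMk (measurable_precodingMatrix f k 1 t)
  have hpast {j : Fin 2} {H H' : Channel}
      (hHH' : ∀ s r' l, (s, r', l) ≠ (t.val, r, j) → H s r' l = H' s r' l) :
      (∀ s < t.val, H s = H' s) ∧ f.row H r k '' Set.Iio t = f.row H' r k '' Set.Iio t := by
    have h (s) (hs : s < t.val) : H s = H' s :=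
      funext fun a => funext fun b => hHH' s a b fun h => hs.ne (congrArg Prod.fst h)
    exact ⟨h, Set.image_congr fun s hs => row_congr f r k fun u hu =>
      h u (hu.trans_lt (Fin.lt_def.1 hs))⟩
  have ae0 := ae_channel_notMem hmeas hindep t r 0
    ((measurableSet_mem_span_row f r k t (measurable_row f r k t)).inter
      (measurableSet_mem_span_row f r k t hw0).compl) (by
    rintro H ⟨h1, h2⟩ H' ⟨h1', -⟩ hHH'
    by_contra hne
    obtain ⟨hlt, himg⟩ := hpast hHH'
    have e1 : H t r 1 = H' t r 1 := hHH' _ _ _ (by simp)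
    simp only [Set.mem_ofPred_eq] at h1 h1'
    rw [← himg] at h1'
    refine h2 ?_
    -- The two rows differ only in the first half, by a nonzero multiple of transmitter `0`'s
    -- precoding vector.
    have hsub := sub_mem h1 h1'
    rw [LinearStrategy.row, LinearStrategy.row, ← precodingMatrix_congr f k 0 hlt,
      ← precodingMatrix_congr f k 1 hlt, ← e1, Prod.mk_sub_mk, sub_self, ← sub_smul] at hsub
    have := smul_mem _ (H t r 0 - H' t r 0)⁻¹ hsub
    rwa [Prod.smul_mk, smul_smul, inv_mul_cancel₀ (sub_ne_zero.2 hne), one_smul,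
      smul_zero] at this)
  have ae1 := ae_channel_notMem hmeas hindep t r 1
    ((measurableSet_mem_span_row f r k t (measurable_row f r k t)).inter
      (measurableSet_mem_span_row f r k t hw1).compl) (by
    rintro H ⟨h1, h2⟩ H' ⟨h1', -⟩ hHH'
    by_contra hne
    obtain ⟨hlt, himg⟩ := hpast hHH'
    have e1 : H t r 0 = H' t r 0 := hHH' _ _ _ (by simp)
    simp only [Set.mem_ofPred_eq] at h1 h1'
    rw [← himg] at h1'
    refine h2 ?_
    have hsub := sub_mem h1 h1'
    rw [LinearStrategy.row, LinearStrategy.row, ← precodingMatrix_congr f k 0 hlt,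
      ← precodingMatrix_congr f k 1 hlt, ← e1, Prod.mk_sub_mk, sub_self, ← sub_smul] at hsub
    have := smul_mem _ (H t r 1 - H' t r 1)⁻¹ hsub
    rwa [Prod.smul_mk, smul_smul, inv_mul_cancel₀ (sub_ne_zero.2 hne), one_smul,
      smul_zero] at this)
  filter_upwards [ae0, ae1] with ω h0 h1 hrow
  exact ⟨by_contra fun h => h0 ⟨hrow, h⟩, by_contra fun h => h1 ⟨hrow, h⟩⟩

theorem dimension_bound_of_decodableAS (hmeas : ∀ t k j, Measurable (g t k j))
    (hindep : iIndepFun (fun i : ℕ × Fin 2 × Fin 2 => g i.1 i.2.1 i.2.2) P)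
    (hatom : ∀ t k j, NullSingletonClass (P.map (g t k j)))
    {f : LinearStrategy n m} (hf : f.DecodableAS P g) (k : Fin 2) :
    2 * (m k 0 + m k 1) + 3 * (m (1 - k) 0 + m (1 - k) 1) ≤ 3 * n := by
  -- The inequality is deterministic, so a single good realization suffices.
  obtain ⟨ω, h1, h2, h3⟩ := (hf.and ((ae_channel_ne_zero hmeas hatom).and
    (ae_generic hmeas hindep hatom f (1 - k) k))).exists
  exact h1.dimension_bound h2 k h3

theorem LinearlyAchievable.bound (hmeas : ∀ t k j, Measurable (g t k j))
    (hindep : iIndepFun (fun i : ℕ × Fin 2 × Fin 2 => g i.1 i.2.1 i.2.2) P)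
    (hatom : ∀ t k j, NullSingletonClass (P.map (g t k j)))
    {d : Fin 2 → Fin 2 → ℝ} (hd : LinearlyAchievable P g d) (k : Fin 2) :
    2 * (d k 0 + d k 1) + 3 * (d (1 - k) 0 + d (1 - k) 1) ≤ 3 := by
  obtain ⟨m, f, hf, hlim⟩ := hd
  refine le_of_tendsto ((((hlim k 0).add (hlim k 1)).const_mul 2).add
    (((hlim (1 - k) 0).add (hlim (1 - k) 1)).const_mul 3)) ?_
  filter_upwards [eventually_ge_atTop 1] with n hn
  have h := dimension_bound_of_decodableAS hmeas hindep hatom (hf n hn) k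
  have hn' : (0 : ℝ) < n := by exact_mod_cast hn
  have h' : 2 * ((m n k 0 : ℝ) + m n k 1) + 3 * (m n (1 - k) 0 + m n (1 - k) 1) ≤ 3 * n := by
    exact_mod_cast h
  rw [← add_div, ← add_div, mul_div_assoc', mul_div_assoc', ← add_div, div_le_iff₀ hn']
  exact h'

theorem linearDoFRegion_bound (hmeas : ∀ t k j, Measurable (g t k j))
    (hindep : iIndepFun (fun i : ℕ × Fin 2 × Fin 2 => g i.1 i.2.1 i.2.2) P)
    (hatom : ∀ t k j, NullSingletonClass (P.map (g t k j)))
    {d : Fin 2 → Fin 2 → ℝ} (hd : d ∈ linearDoFRegion P g) (k : Fin 2) :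
    2 * (d k 0 + d k 1) + 3 * (d (1 - k) 0 + d (1 - k) 1) ≤ 3 := by
  have hclosed : IsClosed {d : Fin 2 → Fin 2 → ℝ |
      2 * (d k 0 + d k 1) + 3 * (d (1 - k) 0 + d (1 - k) 1) ≤ 3} :=
    isClosed_le (by fun_prop) continuous_const
  exact closure_minimal (fun d hd => hd.bound hmeas hindep hatom k) hclosed hd

end XChannel

/-! ### The five-slot strategy and its repetition -/

namespace XChannel

open Module Submodule

variable {n : ℕ} {m : Fin 2 → Fin 2 → ℕ}

/-- The noiseless signal at receiver `r` as a function of all symbols. -/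
def LinearStrategy.receivedSignal (f : LinearStrategy n m) (H : Channel) (r : Fin 2) :
    (∀ k j, Fin (m k j) → ℂ) →ₗ[ℂ] (Fin n → ℂ) :=
  ∑ k, ∑ j, (channelMatrix n H r j * f.precodingMatrix H k j).mulVecLin ∘ₗ
    LinearMap.proj j ∘ₗ LinearMap.proj k

theorem LinearStrategy.receivedSignal_single (f : LinearStrategy n m) (H : Channel) (r k j : Fin 2)
    (c : Fin (m k j) → ℂ) : f.receivedSignal H r (Pi.single k (Pi.single j c)) =
      (channelMatrix n H r j * f.precodingMatrix H k j).mulVec c := by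
  simp only [receivedSignal, LinearMap.sum_apply, LinearMap.comp_apply, LinearMap.proj_apply,
    Matrix.mulVecLin_apply]
  rw [Finset.sum_eq_single k, Finset.sum_eq_single j]
  · simp
  · intro j' _ h
    simp [Pi.single_eq_of_ne h]
  · simp
  · intro k' _ h
    simp [Pi.single_eq_of_ne h]
  · simp

theorem rank_eq_of_mulVec_eq_zero {p : ℕ} {A : Matrix (Fin n) (Fin p) ℂ}
    (h : ∀ c, A.mulVec c = 0 → c = 0) : A.rank = p := by
  rw [Matrix.rank, LinearMap.finrank_range_of_inj, finrank_fin_fun]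
  exact (injective_iff_map_eq_zero A.mulVecLin).2 h

/-- A vector common to a desired stream and its interference yields an input with zero received
signal, whose desired part must therefore vanish. -/
theorem LinearStrategy.decodable_of_receivedSignal {f : LinearStrategy n m} {H : Channel}
    (h : ∀ k x, f.receivedSignal H k x = 0 → ∀ j, x k j = 0) : f.Decodable H := by
  intro k j
  have hinj : ∀ c, (channelMatrix n H k j * f.precodingMatrix H k j).mulVec c = 0 → c = 0 := by
    intro c hc
    rw [← f.receivedSignal_single] at hc
    simpa using h k _ hc j
  have hne (i : Fin 2) : i ≠ 1 - i := by fin_cases i <;> decide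
  refine ⟨?_, ?_⟩
  · rw [finrank_map_starProjection_of_disjoint, LinearStrategy.receivedSpan, finrank_colSpan,
      rank_eq_of_mulVec_eq_zero hinj]
    rw [disjoint_def]
    intro v hv hW
    obtain ⟨c, rfl⟩ := mem_colSpan.1 hv
    simp only [LinearStrategy.interference, Submodule.mem_sup] at hW
    obtain ⟨_, ⟨v₁, h₁, v₂, h₂, rfl⟩, v₃, h₃, hsum⟩ := hW
    obtain ⟨c₁, rfl⟩ := mem_colSpan.1 h₁
    obtain ⟨c₂, rfl⟩ := mem_colSpan.1 h₂
    obtain ⟨c₃, rfl⟩ := mem_colSpan.1 h₃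
    have hsum := (WithLp.toLp_injective 2) hsum
    have hc := h k (Pi.single k (Pi.single j c) - (Pi.single (1 - k) (Pi.single j c₁) +
      Pi.single k (Pi.single (1 - j) c₂) + Pi.single (1 - k) (Pi.single (1 - j) c₃))) (by
        rw [map_sub, map_add, map_add]
        simp only [f.receivedSignal_single]
        exact sub_eq_zero.2 hsum.symm) j
    simp [Pi.single_eq_of_ne (hne _)] at hc
    simp [hc]
  · rw [finrank_colSpan]
    refine rank_eq_of_mulVec_eq_zero fun c hc => hinj c ?_
    rw [← Matrix.mulVec_mulVec, hc, Matrix.mulVec_zero]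

/-- The numbers of symbols of the five-slot strategy. -/
abbrev blockSymbols : Fin 2 → Fin 2 → ℕ := ![![2, 1], ![1, 2]]

/-- The precoding coefficients of the five-slot strategy.  Slots `0` and `1` carry the symbols for
receiver `0`, slots `2` and `3` those for receiver `1`; in slot `4` each transmitter sends the
combination of its symbols which the unintended receiver can already compute. -/
def blockCoeff (H : Channel) : Fin 2 → Fin 2 → ℕ → ℕ → ℂ
  | 0, 0, 0, 0 => 1
  | 0, 0, 1, 1 => 1
  -- Receiver `1` gets these two coefficients by eliminating transmitter `1`'s repeated symbol from
  -- slots `0` and `1`; those of transmitter `1` in slot `4` arise likewise at receiver `0` from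
  -- slots `2` and `3`.
  | 0, 0, 4, 0 => H 1 1 1 * H 0 1 0
  | 0, 0, 4, 1 => -(H 0 1 1 * H 1 1 0)
  | 0, 1, 0, 0 => 1
  | 0, 1, 1, 0 => 1
  | 1, 0, 2, 0 => 1
  | 1, 0, 3, 0 => 1
  | 1, 1, 2, 0 => 1
  | 1, 1, 3, 1 => 1
  | 1, 1, 4, 0 => H 3 0 0 * H 2 0 1
  | 1, 1, 4, 1 => -(H 2 0 0 * H 3 0 1)
  | _, _, _, _ => 0

theorem measurable_blockCoeff (k j : Fin 2) (s i : ℕ) :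
    Measurable fun H : Channel => blockCoeff H k j s i := by
  unfold blockCoeff
  split <;> fun_prop

theorem blockCoeff_congr {H H' : Channel} (k j : Fin 2) {s : ℕ} (i : ℕ)
    (h : ∀ u < s, H u = H' u) : blockCoeff H k j s i = blockCoeff H' k j s i := by
  unfold blockCoeff
  split <;> simp [h]

/-- The strategy which repeats the five-slot strategy in `n / 5` consecutive blocks. -/
def blockStrategy (n : ℕ) : LinearStrategy n fun k j => n / 5 * blockSymbols k j where
  precoder k j t past i :=
    -- Each symbol is used only in its own block, and the last `n % 5` slots stay idle. The default
    -- `0` for slots not yet past is never read, by `blockCoeff_congr`.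
    if ((finProdFinEquiv.symm i).1 : ℕ) = t / 5 then
      blockCoeff (fun s => if h : 5 * (t.val / 5) + s < t then past ⟨_, h⟩ else 0) k j (t % 5)
        (finProdFinEquiv.symm i).2
    else 0
  measurable_precoder k j t := by
    have hpast : Measurable fun (past : Fin t.val → Fin 2 → Fin 2 → ℂ) (s : ℕ) =>
        if h : 5 * (t.val / 5) + s < t then past ⟨_, h⟩ else 0 := by
      refine measurable_pi_lambda _ fun s => ?_
      split <;> fun_prop
    refine measurable_pi_lambda _ fun i => ?_
    split
    · exact (measurable_blockCoeff _ _ _ _).comp hpast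
    · exact measurable_const

theorem blockStrategy_precodingMatrix (n : ℕ) (H : Channel) (k j : Fin 2) (t : Fin n)
    (p : Fin (n / 5) × Fin (blockSymbols k j)) :
    (blockStrategy n).precodingMatrix H k j t (finProdFinEquiv p) =
      if (p.1 : ℕ) = t / 5 then
        blockCoeff (fun s => H (5 * (t / 5) + s)) k j (t % 5) p.2 else 0 := by
  change (if ((finProdFinEquiv.symm (finProdFinEquiv p)).1 : ℕ) = t / 5 then
      blockCoeff (fun s => if h : 5 * (t.val / 5) + s < t then H (5 * (t / 5) + s) else 0) k j
        (t % 5) (finProdFinEquiv.symm (finProdFinEquiv p)).2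
    else 0) = _
  rw [Equiv.symm_apply_apply]
  congr 1
  refine blockCoeff_congr k j _ fun u hu => ?_
  rw [dif_pos (by omega)]

theorem blockStrategy_receivedSignal (n : ℕ) (H : Channel) (r : Fin 2)
    (x : ∀ k j, Fin (n / 5 * blockSymbols k j) → ℂ) (b : Fin (n / 5)) (s : ℕ) (hs : s < 5) :
    (blockStrategy n).receivedSignal H r x ⟨5 * b + s, by omega⟩ =
      ∑ k, ∑ j, H (5 * b + s) r j * ∑ i : Fin (blockSymbols k j),
        blockCoeff (fun s => H (5 * b + s)) k j s i * x k j (finProdFinEquiv (b, i)) := by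
  simp only [LinearStrategy.receivedSignal, LinearMap.sum_apply, LinearMap.comp_apply,
    LinearMap.proj_apply, Matrix.mulVecLin_apply, Finset.sum_apply]
  refine Finset.sum_congr rfl fun k _ => Finset.sum_congr rfl fun j _ => ?_
  rw [channelMatrix, ← Matrix.mulVec_mulVec, Matrix.mulVec_diagonal]
  congr 1
  rw [Matrix.mulVec, dotProduct, ← finProdFinEquiv.sum_comp, Fintype.sum_prod_type]
  simp only [blockStrategy_precodingMatrix]
  have h1 : (5 * b.val + s) / 5 = b := by omega
  have h2 : (5 * b.val + s) % 5 = s := by omega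
  rw [Finset.sum_eq_single b]
  · simp [h1, h2]
  · intro b' _ hb'
    refine Finset.sum_eq_zero fun i _ => ?_
    rw [if_neg, zero_mul]
    rw [h1]
    exact fun h => hb' (Fin.ext h)
  · simp

/-- The determinant which has to be nonzero in slots `s` and `s + 1`. -/
def blockDet (H : Channel) (s : ℕ) : ℂ :=
  H s 0 0 * H (s + 1) 0 1 * H s 1 1 * H (s + 1) 1 0 -
    H s 0 1 * H (s + 1) 0 0 * H s 1 0 * H (s + 1) 1 1

theorem block_decodable {H : Channel} (hH : ∀ t k j, H t k j ≠ 0) (hD : ∀ s, blockDet H s ≠ 0)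
    (r : Fin 2) (y : ∀ k j, Fin (blockSymbols k j) → ℂ)
    (hy : ∀ s < 5, ∑ k, ∑ j, H s r j * ∑ i : Fin (blockSymbols k j),
      blockCoeff H k j s i * y k j i = 0) (j : Fin 2) : y r j = 0 := by
  have hsum (s : ℕ) (hs : s < 5) :
      H s r 0 * (blockCoeff H 0 0 s 0 * y 0 0 (0 : Fin 2) + blockCoeff H 0 0 s 1 * y 0 0 (1 : Fin 2))
      + H s r 1 * (blockCoeff H 0 1 s 0 * y 0 1 (0 : Fin 1))
      + (H s r 0 * (blockCoeff H 1 0 s 0 * y 1 0 (0 : Fin 1))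
      + H s r 1 * (blockCoeff H 1 1 s 0 * y 1 1 (0 : Fin 2) +
        blockCoeff H 1 1 s 1 * y 1 1 (1 : Fin 2))) = 0 := by
    rw [← hy s hs, Fin.sum_univ_two, Fin.sum_univ_two, Fin.sum_univ_two]
    congr 3
    · exact (Fin.sum_univ_two fun i : Fin 2 => blockCoeff H 0 0 s i * y 0 0 i).symm
    · exact (Fin.sum_univ_one fun i : Fin 1 => blockCoeff H 0 1 s i * y 0 1 i).symm
    · exact (Fin.sum_univ_one fun i : Fin 1 => blockCoeff H 1 0 s i * y 1 0 i).symm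
    · exact (Fin.sum_univ_two fun i : Fin 2 => blockCoeff H 1 1 s i * y 1 1 i).symm
  have e0 := hsum 0 (by norm_num)
  have e1 := hsum 1 (by norm_num)
  have e2 := hsum 2 (by norm_num)
  have e3 := hsum 3 (by norm_num)
  have e4 := hsum 4 (by norm_num)
  clear hsum hy
  generalize ha₁ : y 0 0 (0 : Fin 2) = a₁ at *
  generalize ha₂ : y 0 0 (1 : Fin 2) = a₂ at *
  generalize hb : y 0 1 (0 : Fin 1) = b at *
  generalize hc : y 1 0 (0 : Fin 1) = c at *
  generalize hd₁ : y 1 1 (0 : Fin 2) = d₁ at *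
  generalize hd₂ : y 1 1 (1 : Fin 2) = d₂ at *
  simp only [blockCoeff, zero_mul, one_mul, mul_zero, add_zero, zero_add] at e0 e1 e2 e3 e4
  fin_cases r
  · simp only [Fin.zero_eta] at *
    have hL : H 4 0 0 * (H 1 1 1 * H 0 1 0 * a₁ - H 0 1 1 * H 1 1 0 * a₂) = 0 := by
      -- Slots `2` and `3` give receiver `0` the interfering combination of slot `4`, which is
      -- subtracted.
      linear_combination e4 - H 4 0 1 * (H 3 0 0 * e2 - H 2 0 0 * e3)
    have hL := (mul_eq_zero.1 hL).resolve_left (hH _ _ _)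
    -- Eliminating `a₁` and `a₂` from the three remaining equations leaves the determinant times
    -- `b`.
    have hb0 : blockDet H 0 * b = 0 := by
      rw [blockDet]
      linear_combination H 0 0 0 * H 1 0 0 * hL - H 1 1 1 * H 0 1 0 * H 1 0 0 * e0 +
        H 0 1 1 * H 1 1 0 * H 0 0 0 * e1
    obtain rfl := (mul_eq_zero.1 hb0).resolve_left (hD 0)
    have h1 : a₁ = 0 := by simpa [hH] using e0
    have h2 : a₂ = 0 := by simpa [hH] using e1
    fin_cases j
    · funext i
      change Fin 2 at i
      fin_cases i
      · exact ha₁.trans h1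
      · exact ha₂.trans h2
    · funext i
      change Fin 1 at i
      fin_cases i
      exact hb
  · simp only [Fin.mk_one] at *
    have hM : H 4 1 1 * (H 3 0 0 * H 2 0 1 * d₁ - H 2 0 0 * H 3 0 1 * d₂) = 0 := by
      linear_combination e4 - H 4 1 0 * (H 1 1 1 * e0 - H 0 1 1 * e1)
    have hM := (mul_eq_zero.1 hM).resolve_left (hH _ _ _)
    have hc0 : blockDet H 2 * c = 0 := by
      rw [blockDet]
      linear_combination H 2 1 1 * H 3 1 1 * hM - H 3 0 0 * H 2 0 1 * H 3 1 1 * e2 +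
        H 2 0 0 * H 3 0 1 * H 2 1 1 * e3
    obtain rfl := (mul_eq_zero.1 hc0).resolve_left (hD 2)
    have h1 : d₁ = 0 := by simpa [hH] using e2
    have h2 : d₂ = 0 := by simpa [hH] using e3
    fin_cases j
    · funext i
      change Fin 1 at i
      fin_cases i
      exact hc
    · funext i
      change Fin 2 at i
      fin_cases i
      · exact hd₁.trans h1
      · exact hd₂.trans h2

theorem blockStrategy_decodable (n : ℕ) {H : Channel} (hH : ∀ t k j, H t k j ≠ 0)
    (hD : ∀ s, blockDet H s ≠ 0) : (blockStrategy n).Decodable H := by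
  refine LinearStrategy.decodable_of_receivedSignal fun r x hx j => ?_
  funext i
  obtain ⟨⟨b, i⟩, rfl⟩ := finProdFinEquiv.surjective i
  have h := block_decodable (H := fun s => H (5 * b + s)) (fun t k j => hH _ k j)
    (fun s => hD (5 * b + s)) r (fun k j i => x k j (finProdFinEquiv (b, i))) (fun s hs => by
      rw [← blockStrategy_receivedSignal n H r x b s hs, hx]
      rfl) j
  exact congrFun h i

variable {Ω : Type*} [MeasurableSpace Ω] {P : Measure Ω} [IsProbabilityMeasure P]
  {g : ℕ → Fin 2 → Fin 2 → Ω → ℂ}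

theorem ae_blockDet_ne_zero (hmeas : ∀ t k j, Measurable (g t k j))
    (hindep : iIndepFun (fun i : ℕ × Fin 2 × Fin 2 => g i.1 i.2.1 i.2.2) P)
    (hatom : ∀ t k j, NullSingletonClass (P.map (g t k j))) :
    ∀ᵐ ω ∂P, ∀ s, blockDet (fun t k j => g t k j ω) s ≠ 0 := by
  rw [ae_all_iff]
  intro s
  -- The determinant is affine in `H s 0 0`; the second condition makes its slope nonzero, so its
  -- vanishing determines that coefficient.
  have hB : MeasurableSet {H : Channel | blockDet H s = 0 ∧
      H (s + 1) 0 1 * H s 1 1 * H (s + 1) 1 0 ≠ 0} := by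
    refine (measurableSet_eq_fun ?_ measurable_const).inter
      (measurableSet_eq_fun ?_ measurable_const).compl
    · unfold blockDet
      fun_prop
    · fun_prop
  filter_upwards [ae_channel_ne_zero hmeas hatom, ae_channel_notMem hmeas hindep s 0 0 hB (by
    rintro H ⟨h, hne⟩ H' ⟨h', -⟩ hHH'
    rw [blockDet] at h h'
    rw [← hHH' s 0 1 (by simp), ← hHH' s 1 0 (by simp), ← hHH' s 1 1 (by simp),
      ← hHH' (s + 1) 0 0 (by simp), ← hHH' (s + 1) 0 1 (by simp), ← hHH' (s + 1) 1 0 (by simp),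
      ← hHH' (s + 1) 1 1 (by simp)] at h'
    refine mul_right_cancel₀ hne ?_
    linear_combination h - h')] with ω h1 h2 h3
  exact h2 ⟨h3, mul_ne_zero (mul_ne_zero (h1 _ _ _) (h1 _ _ _)) (h1 _ _ _)⟩

theorem blockStrategy_decodableAS (hmeas : ∀ t k j, Measurable (g t k j))
    (hindep : iIndepFun (fun i : ℕ × Fin 2 × Fin 2 => g i.1 i.2.1 i.2.2) P)
    (hatom : ∀ t k j, NullSingletonClass (P.map (g t k j))) (n : ℕ) :
    (blockStrategy n).DecodableAS P g := by
  filter_upwards [ae_channel_ne_zero hmeas hatom, ae_blockDet_ne_zero hmeas hindep hatom]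
    with ω h1 h2
  exact blockStrategy_decodable n h1 h2

theorem tendsto_div_five : Tendsto (fun n : ℕ => ((n / 5 : ℕ) : ℝ) / n) atTop (𝓝 (1 / 5)) := by
  have hlow : Tendsto (fun n : ℕ => (1 / 5 : ℝ) - 1 / n) atTop (𝓝 (1 / 5)) := by
    simpa using (tendsto_const_nhds (x := (1 / 5 : ℝ))).sub tendsto_one_div_atTop_nhds_zero_nat
  refine tendsto_of_tendsto_of_tendsto_of_le_of_le' hlow tendsto_const_nhds ?_ ?_
  all_goals
    filter_upwards [eventually_ge_atTop 1] with n hn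
    have hn' : (0 : ℝ) < n := by exact_mod_cast hn
  · have h : (n : ℝ) ≤ 5 * (n / 5 : ℕ) + 5 := by exact_mod_cast (by omega : n ≤ 5 * (n / 5) + 5)
    rw [le_div_iff₀ hn', sub_mul, one_div_mul_cancel hn'.ne']
    linarith
  · have h : 5 * ((n / 5 : ℕ) : ℝ) ≤ n := by exact_mod_cast (by omega : 5 * (n / 5) ≤ n)
    rw [div_le_iff₀ hn']
    linarith

theorem linearlyAchievable_block (hmeas : ∀ t k j, Measurable (g t k j))
    (hindep : iIndepFun (fun i : ℕ × Fin 2 × Fin 2 => g i.1 i.2.1 i.2.2) P)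
    (hatom : ∀ t k j, NullSingletonClass (P.map (g t k j))) :
    LinearlyAchievable P g fun k j => (blockSymbols k j : ℝ) / 5 := by
  refine ⟨_, blockStrategy, fun n _ => blockStrategy_decodableAS hmeas hindep hatom n,
    fun k j => ?_⟩
  have h := tendsto_div_five.mul_const (blockSymbols k j : ℝ)
  rw [one_div_mul_eq_div] at h
  refine h.congr fun n => ?_
  push_cast
  ring

end XChannel

theorem theorem1 {Ω : Type*} [MeasurableSpace Ω] (P : Measure Ω) [IsProbabilityMeasure P]
    (g : ℕ → Fin 2 → Fin 2 → Ω → ℂ)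
    (hmeas : ∀ t k j, Measurable (g t k j))
    (hindep : iIndepFun (fun i : ℕ × Fin 2 × Fin 2 => g i.1 i.2.1 i.2.2) P)
    (ν : Measure ℂ) [NullSingletonClass ν]
    (hlaw : ∀ t k j, P.map (g t k j) = ν) :
    XChannel.IsSumLinearDoF P g (6 / 5) ∧
    (∀ d ∈ XChannel.linearDoFRegion P g,
      d 0 0 + d 0 1 + 3 / 2 * (d 1 0 + d 1 1) ≤ 3 / 2 ∧
      3 / 2 * (d 0 0 + d 0 1) + (d 1 0 + d 1 1) ≤ 3 / 2) ∧
    ∃ f : XChannel.LinearStrategy 5 ![![2, 1], ![1, 2]], f.DecodableAS P g := by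
  have hatom (t k j) : NullSingletonClass (P.map (g t k j)) := by rw [hlaw]; infer_instance
  have hregion : ∀ d ∈ XChannel.linearDoFRegion P g,
      d 0 0 + d 0 1 + 3 / 2 * (d 1 0 + d 1 1) ≤ 3 / 2 ∧
      3 / 2 * (d 0 0 + d 0 1) + (d 1 0 + d 1 1) ≤ 3 / 2 := by
    intro d hd
    have h0 := XChannel.linearDoFRegion_bound hmeas hindep hatom hd 0
    have h1 := XChannel.linearDoFRegion_bound hmeas hindep hatom hd 1
    rw [sub_zero] at h0
    rw [sub_self] at h1
    constructor <;> linarith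
  refine ⟨⟨⟨_, subset_closure (XChannel.linearlyAchievable_block hmeas hindep hatom), ?_⟩, ?_⟩,
    hregion, ?_⟩
  · simp only [Fin.sum_univ_two, XChannel.blockSymbols]
    norm_num
  · rintro _ ⟨d, hd, rfl⟩
    have h := hregion d hd
    simp only [Fin.sum_univ_two]
    linarith
  · have hm : (fun k j => 5 / 5 * XChannel.blockSymbols k j) = ![![2, 1], ![1, 2]] := by
      funext k j
      simp
    rw [← hm]
    exact ⟨_, XChannel.blockStrategy_decodableAS hmeas hindep hatom 5⟩
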